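/- Let $a_0>0$, let $p\in C([0,1])$ satisfy $p(x)>0$ for all $x\in[0,1]$, and let $g:[0,1]\times\mathbb R\to\mathbb R$ be continuous, with $g(x,0)=0$ for all $x\in[0,1]$, and of class $C^1$ with respect to $u$ (that is, $\partial g/\partial u$ exists and is continuous on $[0,1]\times\mathbb R$). Assume that $g(x,\cdot)$ is strictly increasing for every $x\in[0,1]$ and that $g$ is superlinear: $$\lim_{|u|\to+\infty}\frac{g(x,u)}{u}=+\infty\quad\text{uniformly in }x\in[0,1].$$ For $a_1>0$ consider the radiation problem $$u''(x)=g(x,u(x))+p(x)\quad (0\le x\le 1),\qquad u'(0)=a_0u(0),\quad u'(1)=a_1u(1).$$ Then there exist constants $a^*>a_*>0$ (depending only on $a_0$, $g$ and $p$) such that: 1. If $a_1>a^*$, then the problem has at least three different solutions, one of them negative on $[0,1]$ and another one sign-changing (that is, taking both negative and positive values on $[0,1]$). 2. If $0<a_1<a_*$, then the problem has a unique solution, and this solution is negative on $[0,1]$. -/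

import Mathlib

open Set

/-- `g : [0,1] × ℝ → ℝ` is continuous, and it is of class `C¹` with respect to `u`: the partial
derivative `∂g/∂u` exists and is continuous on `[0,1] × ℝ`. (Values of `g x u` with `x ∉ [0,1]`
play no role.) -/
structure IsC1InSecond (g : ℝ → ℝ → ℝ) : Prop where
  continuousOn : ContinuousOn (fun q : ℝ × ℝ => g q.1 q.2) (Icc (0 : ℝ) 1 ×ˢ univ)
  differentiable : ∀ x ∈ Icc (0 : ℝ) 1, Differentiable ℝ (g x)
  continuousOn_deriv :
    ContinuousOn (fun q : ℝ × ℝ => deriv (g q.1) q.2) (Icc (0 : ℝ) 1 ×ˢ univ)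

/-- Superlinearity: `g(x,u)/u → +∞` as `|u| → +∞`, uniformly in `x ∈ [0,1]`. -/
def IsSuperlinear (g : ℝ → ℝ → ℝ) : Prop :=
  ∀ M : ℝ, ∃ R : ℝ, 0 < R ∧ ∀ x ∈ Icc (0 : ℝ) 1, ∀ u : ℝ, R ≤ |u| → M ≤ g x u / u

/-- `u` is, on `[0,1]`, a classical (twice differentiable, one-sidedly at the end points) solution
of `u'' = g(x,u) + p(x)` with the radiation boundary conditions `u'(0) = a₀ u(0)`,
`u'(1) = a₁ u(1)`. Only the values of `u` on `[0,1]` matter. -/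
structure IsRadiationSolution (g : ℝ → ℝ → ℝ) (p : ℝ → ℝ) (a₀ a₁ : ℝ) (u : ℝ → ℝ) : Prop where
  differentiableOn : DifferentiableOn ℝ u (Icc (0 : ℝ) 1)
  equation : ∀ x ∈ Icc (0 : ℝ) 1,
    HasDerivWithinAt (derivWithin u (Icc (0 : ℝ) 1)) (g x (u x) + p x) (Icc (0 : ℝ) 1) x
  left_bc : derivWithin u (Icc (0 : ℝ) 1) 0 = a₀ * u 0
  right_bc : derivWithin u (Icc (0 : ℝ) 1) 1 = a₁ * u 1

/-- `u` is negative on all of `[0,1]`. -/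
def IsNegativeOnUnit (u : ℝ → ℝ) : Prop := ∀ x ∈ Icc (0 : ℝ) 1, u x < 0

/-- `u` changes sign on `[0,1]`. -/
def IsSignChangingOnUnit (u : ℝ → ℝ) : Prop :=
  (∃ x ∈ Icc (0 : ℝ) 1, u x < 0) ∧ (∃ y ∈ Icc (0 : ℝ) 1, 0 < u y)

/-! Shooting from the left end. For each `s` let `u` solve the equation with `u(0) = s`, `u'(0) = a₀
s`; solutions are the zeros of `F(s) = u'(1) - a₁ u(1)`. Since `g` increases in `u`, the difference
of two shots is convex where positive, so shots separate by at least their initial gap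
(`IsShot.sub_le_sub`). Hence some shot has `u(1) = 0`; as `p > 0`, it has `u'(1) > 0` and `u(0) <
0`, so `F > 0` there for every `a₁`. Superlinearity (`lt_of_superlinear`) gives `F < 0` for very
negative `s` and `F > 0` for very positive `s`. The first change of sign yields a negative solution
for every `a₁`. A slightly higher shot has `u(0) < 0 < u(1)`, and `F < 0` there once `a₁` is large:
this gives two more zeros, the lower one sign-changing.

For small `a₁`, comparing the difference of two solutions with multiples of `1 + a₀ x` gives
uniqueness.

Shots of the superlinear equation may blow up, so `g` is replaced by a globally Lipschitz truncation
that the a priori bounds make invisible. -/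

/-! ### Maximum principle and comparison functions -/

theorem exists_lt_of_deriv_pos_right {u v : ℝ → ℝ} {a b q : ℝ} (hab : a < b)
    (hu : ∀ x ∈ Icc a b, HasDerivWithinAt u (v x) (Icc a b) x)
    (hv : HasDerivWithinAt v q (Icc a b) a) (hva : 0 ≤ v a) (hq : 0 < q) :
    ∃ y ∈ Icc a b, u a < u y := by
  have h1 : ∀ᶠ y in nhdsWithin a (Ioi a), 0 < slope v a y := by
    have := (hasDerivWithinAt_iff_tendsto_slope.1 hv).eventually (lt_mem_nhds hq)
    rwa [Icc_sdiff_left, nhdsWithin_Ioc_eq_nhdsGT hab] at this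
  obtain ⟨c, hc, hsub⟩ := mem_nhdsGT_iff_exists_Ioc_subset.1 h1
  have hac : a < min b c := lt_min hab hc
  have hss : Icc a (min b c) ⊆ Icc a b := Icc_subset_Icc le_rfl (min_le_left _ _)
  have hmono : StrictMonoOn u (Icc a (min b c)) := by
    refine strictMonoOn_of_deriv_pos (convex_Icc _ _)
      (fun x hx => ((hu x (hss hx)).continuousWithinAt).mono hss) ?_
    intro x hx
    rw [interior_Icc] at hx
    have hxc : x ≤ c := hx.2.le.trans (min_le_right _ _)
    have hxb : x < b := hx.2.trans_le (min_le_left _ _)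
    rw [((hu x ⟨hx.1.le, hxb.le⟩).hasDerivAt (Icc_mem_nhds hx.1 hxb)).deriv]
    have hs : 0 < slope v a x := hsub ⟨hx.1, hxc⟩
    rw [slope_def_field, div_pos_iff_of_pos_right (sub_pos.2 hx.1)] at hs
    linarith
  exact ⟨min b c, hss ⟨hac.le, le_rfl⟩, hmono ⟨le_rfl, hac.le⟩ ⟨hac.le, le_rfl⟩ hac⟩

theorem exists_lt_of_deriv_pos_left {u v : ℝ → ℝ} {a b q : ℝ} (hab : a < b)
    (hu : ∀ x ∈ Icc a b, HasDerivWithinAt u (v x) (Icc a b) x)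
    (hv : HasDerivWithinAt v q (Icc a b) b) (hvb : v b ≤ 0) (hq : 0 < q) :
    ∃ y ∈ Icc a b, u b < u y := by
  have h1 : ∀ᶠ y in nhdsWithin b (Iio b), 0 < slope v b y := by
    have := (hasDerivWithinAt_iff_tendsto_slope.1 hv).eventually (lt_mem_nhds hq)
    rwa [Icc_sdiff_right, nhdsWithin_Ico_eq_nhdsLT hab] at this
  obtain ⟨c, hc, hsub⟩ := mem_nhdsLT_iff_exists_Ico_subset.1 h1
  have hac : max a c < b := max_lt hab hc
  have hss : Icc (max a c) b ⊆ Icc a b := Icc_subset_Icc (le_max_left _ _) le_rfl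
  have hmono : StrictAntiOn u (Icc (max a c) b) := by
    refine strictAntiOn_of_deriv_neg (convex_Icc _ _)
      (fun x hx => ((hu x (hss hx)).continuousWithinAt).mono hss) ?_
    intro x hx
    rw [interior_Icc] at hx
    have hxc : c ≤ x := (le_max_right _ _).trans hx.1.le
    have hxa : a < x := (le_max_left _ _).trans_lt hx.1
    rw [((hu x ⟨hxa.le, hx.2.le⟩).hasDerivAt (Icc_mem_nhds hxa hx.2)).deriv]
    have hs : 0 < slope v b x := hsub ⟨hxc, hx.2⟩
    rw [slope_def_field, div_pos_iff] at hs
    rcases hs with hs | hs <;> linarith [hx.2]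
  exact ⟨max a c, hss ⟨le_rfl, hac.le⟩, hmono ⟨le_rfl, hac.le⟩ ⟨hac.le, le_rfl⟩ hac⟩

/-- A maximum point at which the second derivative is positive is an end point, and the first
derivative there points strictly outwards. -/
theorem isMaxOn_deriv_pos_endpoint {u v q : ℝ → ℝ} {a b x : ℝ} (hab : a < b)
    (hu : ∀ x ∈ Icc a b, HasDerivWithinAt u (v x) (Icc a b) x)
    (hv : ∀ x ∈ Icc a b, HasDerivWithinAt v (q x) (Icc a b) x)
    (hx : x ∈ Icc a b) (hmax : ∀ y ∈ Icc a b, u y ≤ u x) (hq : 0 < q x) :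
    (x = a ∧ v a < 0) ∨ (x = b ∧ 0 < v b) := by
  have hr : x < b → v x < 0 := by
    intro hxb
    by_contra! h
    have hss : Icc x b ⊆ Icc a b := Icc_subset_Icc hx.1 le_rfl
    obtain ⟨y, hy, hlt⟩ := exists_lt_of_deriv_pos_right hxb
      (fun z hz => (hu z (hss hz)).mono hss) ((hv x hx).mono hss) h hq
    exact absurd (hmax y (hss hy)) (not_le.2 hlt)
  have hl : a < x → 0 < v x := by
    intro hxa
    by_contra! h
    have hss : Icc a x ⊆ Icc a b := Icc_subset_Icc le_rfl hx.2
    obtain ⟨y, hy, hlt⟩ := exists_lt_of_deriv_pos_left hxa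
      (fun z hz => (hu z (hss hz)).mono hss) ((hv x hx).mono hss) h hq
    exact absurd (hmax y (hss hy)) (not_le.2 hlt)
  rcases hx.1.eq_or_lt with h | h
  · subst h; exact Or.inl ⟨rfl, hr hab⟩
  · rcases hx.2.eq_or_lt with h' | h'
    · subst h'; exact Or.inr ⟨rfl, hl hab⟩
    · exact absurd (hl h) (not_lt.2 (hr h').le)

/-- The smallest multiple of a positive function `φ` lying above `u` touches `u`; if `u - c φ` has
positive second derivative at the contact point, that point is an end point. -/
theorem exists_touching {u v q φ φ₁ φ₂ : ℝ → ℝ}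
    (hu : ∀ x ∈ Icc (0 : ℝ) 1, HasDerivWithinAt u (v x) (Icc 0 1) x)
    (hv : ∀ x ∈ Icc (0 : ℝ) 1, HasDerivWithinAt v (q x) (Icc 0 1) x)
    (hφ : ∀ x, HasDerivAt φ (φ₁ x) x) (hφ₁ : ∀ x, HasDerivAt φ₁ (φ₂ x) x)
    (hpos : ∀ x ∈ Icc (0 : ℝ) 1, 0 < φ x) :
    ∃ c : ℝ, ∃ x ∈ Icc (0 : ℝ) 1, u x = c * φ x ∧ (∀ y ∈ Icc (0 : ℝ) 1, u y ≤ c * φ y) ∧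
      (c * φ₂ x < q x → (x = 0 ∧ v 0 < c * φ₁ 0) ∨ (x = 1 ∧ c * φ₁ 1 < v 1)) := by
  have hcont : ContinuousOn (fun x => u x / φ x) (Icc 0 1) :=
    ContinuousOn.div (fun x hx => (hu x hx).continuousWithinAt)
      (fun x _ => (hφ x).continuousAt.continuousWithinAt) (fun x hx => (hpos x hx).ne')
  obtain ⟨x, hx, hmax⟩ := isCompact_Icc.exists_isMaxOn (nonempty_Icc.2 zero_le_one) hcont
  have hxe : u x = u x / φ x * φ x := (div_mul_cancel₀ _ (hpos x hx).ne').symm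
  have hle : ∀ y ∈ Icc (0 : ℝ) 1, u y ≤ u x / φ x * φ y := fun y hy =>
    (div_le_iff₀ (hpos y hy)).1 (hmax hy)
  refine ⟨u x / φ x, x, hx, hxe, hle, fun hq => ?_⟩
  set c := u x / φ x
  have key := isMaxOn_deriv_pos_endpoint (u := fun y => u y - c * φ y)
    (v := fun y => v y - c * φ₁ y) (q := fun y => q y - c * φ₂ y) zero_lt_one
    (fun y hy => (hu y hy).sub ((hφ y).const_mul c).hasDerivWithinAt)
    (fun y hy => (hv y hy).sub ((hφ₁ y).const_mul c).hasDerivWithinAt) hx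
    (fun y hy => by linarith [hle y hy]) (by linarith)
  rcases key with h | h
  · exact Or.inl ⟨h.1, by linarith [h.2]⟩
  · exact Or.inr ⟨h.1, by linarith [h.2]⟩

/-- A priori bound: `u'' ≥ M u` where `u ≥ R`, with `M` large compared with `a₁`. -/
theorem lt_of_superlinear {u v q : ℝ → ℝ} {a₀ a₁ R : ℝ} {n : ℕ} (ha₀ : 0 < a₀) (hR : 0 < R)
    (hn : 2 ≤ n) (hna : 2 * a₁ ≤ n)
    (hu : ∀ x ∈ Icc (0 : ℝ) 1, HasDerivWithinAt u (v x) (Icc 0 1) x)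
    (hv : ∀ x ∈ Icc (0 : ℝ) 1, HasDerivWithinAt v (q x) (Icc 0 1) x)
    (hq : ∀ x ∈ Icc (0 : ℝ) 1, R ≤ u x → ((n : ℝ) ^ 2 + 1) * u x ≤ q x)
    (h0 : v 0 = a₀ * u 0) (h1 : v 1 ≤ a₁ * u 1) :
    ∀ x ∈ Icc (0 : ℝ) 1, u x < 2 * R := by
  obtain ⟨m, rfl⟩ := Nat.exists_eq_add_of_le hn
  -- With `n = 2 + m`, `φ = (1 + xⁿ)/2` has `1/2 ≤ φ ≤ 1`, `φ'(0) = 0`, `φ(1) = 1`, `φ'(1) = n/2 ≥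
  -- a₁` and `φ'' ≤ n²/2`. The boundary conditions thus exclude contact at either end, and the
  -- growth of `q` excludes it inside.
  obtain ⟨c, x, hx, hxc, hle, key⟩ := exists_touching (φ := fun x => 1 / 2 + x ^ (2 + m) / 2)
    (φ₁ := fun x => ((2 + m : ℕ) : ℝ) * x ^ (1 + m) / 2)
    (φ₂ := fun x => ((2 + m : ℕ) : ℝ) * (((1 + m : ℕ) : ℝ) * x ^ m) / 2) hu hv
    (fun x => by
      have := ((hasDerivAt_pow (2 + m) x).div_const 2).const_add (1 / 2)
      rwa [show 2 + m - 1 = 1 + m by omega] at this)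
    (fun x => by
      have := ((hasDerivAt_pow (1 + m) x).const_mul ((2 + m : ℕ) : ℝ)).div_const 2
      rwa [show 1 + m - 1 = m by omega] at this)
    (fun x hx => by have := pow_nonneg hx.1 (2 + m); positivity)
  intro y hy
  by_contra! hyR
  have hpow : ∀ k : ℕ, ∀ z ∈ Icc (0 : ℝ) 1, 0 ≤ z ^ k ∧ z ^ k ≤ 1 := fun k z hz =>
    ⟨pow_nonneg hz.1 k, pow_le_one₀ hz.1 hz.2⟩
  have hc : 2 * R ≤ c := by
    by_contra! hc
    have h2 := hpow (2 + m) y hy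
    have h3 := hle y hy
    nlinarith
  -- As `φ ≥ 1/2`, the contact value is at least `c/2 ≥ R`, so the growth hypothesis applies there.
  have hxR : c / 2 ≤ u x := by
    rw [hxc]; have := (hpow (2 + m) x hx).1
    nlinarith
  have hxpos : 0 < u x := by linarith
  have hn0 : (0 : ℝ) ≤ m := Nat.cast_nonneg m
  rcases key (by
    refine lt_of_lt_of_le ?_ (hq x hx (by linarith))
    have h4 := hpow m x hx
    have h5 : ((2 + m : ℕ) : ℝ) * (((1 + m : ℕ) : ℝ) * x ^ m) / 2
        ≤ ((2 + m : ℕ) : ℝ) ^ 2 / 2 := by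
      push_cast
      have : (1 + (m : ℝ)) * x ^ m ≤ (2 + m) := by nlinarith
      nlinarith
    have h6 : c * (((2 + m : ℕ) : ℝ) * (((1 + m : ℕ) : ℝ) * x ^ m) / 2)
        ≤ c * (((2 + m : ℕ) : ℝ) ^ 2 / 2) := by gcongr; linarith
    have h7 : (((2 + m : ℕ) : ℝ) ^ 2 + 1) * (c / 2) ≤ (((2 + m : ℕ) : ℝ) ^ 2 + 1) * u x := by
      gcongr
    linarith) with ⟨rfl, h⟩ | ⟨rfl, h⟩
  · have : 0 < a₀ * u 0 := by positivity
    simp at h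
    linarith
  · simp only [one_pow] at h hxc
    have : u 1 = c := by linarith
    rw [this] at h1
    nlinarith

/-- A function convex where it is positive and satisfying the radiation conditions with small `a₁`
is nonpositive. -/
theorem nonpos_of_convex_where_pos {u v q : ℝ → ℝ} {a₀ a₁ : ℝ} (ha₀ : 0 < a₀)
    (ha₁ : a₁ < a₀ / (1 + a₀))
    (hu : ∀ x ∈ Icc (0 : ℝ) 1, HasDerivWithinAt u (v x) (Icc 0 1) x)
    (hv : ∀ x ∈ Icc (0 : ℝ) 1, HasDerivWithinAt v (q x) (Icc 0 1) x)
    (hq : ∀ x ∈ Icc (0 : ℝ) 1, 0 < u x → 0 < q x)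
    (h0 : v 0 = a₀ * u 0) (h1 : v 1 = a₁ * u 1) :
    ∀ x ∈ Icc (0 : ℝ) 1, u x ≤ 0 := by
  -- This affine function satisfies the left condition exactly, and `φ'(1)/φ(1) = a₀/(1 + a₀)`:
  -- hence the threshold on `a₁`.
  obtain ⟨c, x, hx, hxc, hle, key⟩ := exists_touching (φ := fun x => 1 + a₀ * x)
    (φ₁ := fun _ => a₀) (φ₂ := fun _ => 0) hu hv
    (fun x => by simpa using ((hasDerivAt_id x).const_mul a₀).const_add 1)
    (fun x => hasDerivAt_const x a₀)
    (fun x hx => by have := mul_nonneg ha₀.le hx.1; positivity)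
  have hφ : ∀ y ∈ Icc (0 : ℝ) 1, 0 < 1 + a₀ * y := fun y hy => by
    have := mul_nonneg ha₀.le hy.1; positivity
  rcases le_or_gt c 0 with hc | hc
  · exact fun y hy => (hle y hy).trans (mul_nonpos_of_nonpos_of_nonneg hc (hφ y hy).le)
  · exfalso
    have hxpos : 0 < u x := by rw [hxc]; exact mul_pos hc (hφ x hx)
    rcases key (by simpa using hq x hx hxpos) with ⟨rfl, h⟩ | ⟨rfl, h⟩
    · rw [h0, hxc] at h; simp at h; linarith
    · rw [h1, hxc] at h
      rw [lt_div_iff₀ (by positivity)] at ha₁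
      simp only [mul_one] at h
      nlinarith

/-- A function convex where it is positive, with `0 < u(0)` and `u'(0) = a₀ u(0)`, stays above its
initial value. -/
theorem le_of_convex_where_pos {u v q : ℝ → ℝ} {a₀ : ℝ} (ha₀ : 0 < a₀)
    (hu : ∀ x ∈ Icc (0 : ℝ) 1, HasDerivWithinAt u (v x) (Icc 0 1) x)
    (hv : ∀ x ∈ Icc (0 : ℝ) 1, HasDerivWithinAt v (q x) (Icc 0 1) x)
    (hq : ∀ x ∈ Icc (0 : ℝ) 1, 0 < u x → 0 < q x)
    (h0 : v 0 = a₀ * u 0) (h00 : 0 < u 0) :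
    ∀ x ∈ Icc (0 : ℝ) 1, u 0 ≤ u x := by
  intro b hb
  rcases hb.1.eq_or_lt with h | hb0
  · rw [← h]
  have hss : Icc 0 b ⊆ Icc (0 : ℝ) 1 := Icc_subset_Icc le_rfl hb.2
  obtain ⟨x, hx, hmax⟩ := isCompact_Icc.exists_isMaxOn (nonempty_Icc.2 hb0.le)
    (fun x hx => ((hu x (hss hx)).continuousWithinAt).mono hss : ContinuousOn u (Icc 0 b))
  have hx0 : u 0 ≤ u x := hmax (⟨le_rfl, hb0.le⟩ : (0 : ℝ) ∈ Icc 0 b)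
  rcases isMaxOn_deriv_pos_endpoint hb0 (fun z hz => (hu z (hss hz)).mono hss)
    (fun z hz => (hv z (hss hz)).mono hss) hx (fun y hy => hmax hy)
    (hq x (hss hx) (by linarith)) with ⟨rfl, h⟩ | ⟨rfl, h⟩
  · have : 0 < a₀ * u 0 := by positivity
    linarith
  · exact hx0

/-! ### Shots: existence, dependence on the initial value, separation -/

/-- `u`, with derivative `v`, solves `u'' = H(x,u)` on `[0,1]` with `u'(0) = a₀ u(0)`. -/
structure IsShot (H : ℝ → ℝ → ℝ) (a₀ : ℝ) (u v : ℝ → ℝ) : Prop where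
  hu : ∀ x ∈ Icc (0 : ℝ) 1, HasDerivWithinAt u (v x) (Icc 0 1) x
  hv : ∀ x ∈ Icc (0 : ℝ) 1, HasDerivWithinAt v (H x (u x)) (Icc 0 1) x
  bc : v 0 = a₀ * u 0

/-- Truncation of `u` to `[-N, N]`. -/
def clamp (N u : ℝ) : ℝ := max (-N) (min N u)

theorem abs_clamp_sub_le (N u w : ℝ) : |clamp N u - clamp N w| ≤ |u - w| := by
  unfold clamp
  calc |max (-N) (min N u) - max (-N) (min N w)| ≤ |min N u - min N w| := by
        simpa using abs_max_sub_max_le_max (-N) (min N u) (-N) (min N w)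
    _ ≤ |u - w| := by simpa using abs_min_sub_min_le_max N u N w

theorem clamp_eq_self {N u : ℝ} (h : |u| ≤ N) : clamp N u = u := by
  rw [abs_le] at h
  rw [clamp, min_eq_right h.2, max_eq_right h.1]

theorem clamp_zero {N : ℝ} (hN : 0 ≤ N) : clamp N 0 = 0 := clamp_eq_self (by simpa using hN)

theorem abs_clamp_le {N : ℝ} (hN : 0 ≤ N) (u : ℝ) : |clamp N u| ≤ N :=
  abs_le.2 ⟨le_max_left _ _, max_le (by linarith) (min_le_left _ _)⟩

theorem abs_clamp_le_abs {N : ℝ} (hN : 0 ≤ N) (u : ℝ) : |clamp N u| ≤ |u| := by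
  simpa [clamp_zero hN] using abs_clamp_sub_le N u 0

theorem clamp_eq_right {N u : ℝ} (hN : 0 ≤ N) (h : N ≤ u) : clamp N u = N := by
  rw [clamp, min_eq_left h, max_eq_right (by linarith)]

theorem clamp_eq_left {N u : ℝ} (hN : 0 ≤ N) (h : u ≤ -N) : clamp N u = -N := by
  rw [clamp, min_eq_right (by linarith), max_eq_left h]

theorem clamp_mono (N : ℝ) : Monotone (clamp N) := fun _ _ h =>
  max_le_max le_rfl (min_le_min le_rfl h)

theorem hasDerivWithinAt_Ici_of_Icc {E : Type*} [NormedAddCommGroup E] [NormedSpace ℝ E]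
    {f : ℝ → E} {f' : E} {a b x : ℝ}
    (h : HasDerivWithinAt f f' (Icc a b) x) (hx : x ∈ Ico a b) :
    HasDerivWithinAt f f' (Ici x) x :=
  h.mono_of_mem_nhdsWithin (Filter.mem_of_superset (Icc_mem_nhdsGE hx.2)
    (Icc_subset_Icc hx.1 le_rfl))

/-- Serves both the original first-order system (`k` the identity) and the one with clamped state
(`k = clamp B`). -/
theorem lipschitz_field {h : ℝ → ℝ} {L : NNReal} (hL : ∀ u w, |h u - h w| ≤ L * |u - w|)
    {k : ℝ → ℝ} (hk : ∀ u w, |k u - k w| ≤ |u - w|) :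
    LipschitzWith (1 + L) (fun y : ℝ × ℝ => (k y.2, h (k y.1))) := by
  refine LipschitzWith.of_dist_le_mul fun y z => ?_
  rw [Prod.dist_eq]
  have h1 : |y.1 - z.1| ≤ dist y z := by
    rw [Prod.dist_eq, ← Real.dist_eq]; exact le_max_left _ _
  have h2 : |y.2 - z.2| ≤ dist y z := by
    rw [Prod.dist_eq, ← Real.dist_eq]; exact le_max_right _ _
  have hd : 0 ≤ dist y z := dist_nonneg
  have hL0 : (0 : ℝ) ≤ L := L.2
  simp only [Real.dist_eq]
  push_cast
  refine max_le ?_ ?_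
  · nlinarith [hk y.2 z.2]
  · have h3 := hL (k y.1) (k z.1)
    have h4 : (L : ℝ) * |k y.1 - k z.1| ≤ L * dist y z := by
      gcongr; exact (hk _ _).trans h1
    nlinarith

theorem IsShot.hasDerivWithinAt_prodMk {H : ℝ → ℝ → ℝ} {a₀ : ℝ} {u v : ℝ → ℝ}
    (h : IsShot H a₀ u v) {x : ℝ} (hx : x ∈ Icc (0 : ℝ) 1) :
    HasDerivWithinAt (fun t => (u t, v t)) (v x, H x (u x)) (Icc 0 1) x :=
  (h.hu x hx).prodMk (h.hv x hx)

/-- Lipschitz dependence of shots on the initial value. -/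
theorem IsShot.dist_le {H : ℝ → ℝ → ℝ} {a₀ : ℝ} {L : NNReal}
    (hL : ∀ x ∈ Icc (0 : ℝ) 1, ∀ u w, |H x u - H x w| ≤ L * |u - w|) :
    ∃ C : ℝ, 0 < C ∧ ∀ u v u' v' : ℝ → ℝ, IsShot H a₀ u v → IsShot H a₀ u' v' →
      ∀ x ∈ Icc (0 : ℝ) 1, |u x - u' x| ≤ C * |u 0 - u' 0| ∧ |v x - v' x| ≤ C * |u 0 - u' 0| := by
  -- The factor `1 + |a₀|` accounts for the initial slopes `a₀ u(0)`; the exponential is Gronwall's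
  -- factor over unit time.
  refine ⟨(1 + |a₀|) * Real.exp ((1 + L : NNReal) * 1), by positivity, ?_⟩
  intro u v u' v' h h' x hx
  have key := dist_le_of_trajectories_ODE_of_mem (K := 1 + L) (a := 0) (b := 1)
    (v := fun t (y : ℝ × ℝ) => (y.2, H t y.1)) (s := fun _ => univ)
    (f := fun t => (u t, v t)) (g := fun t => (u' t, v' t))
    (δ := (1 + |a₀|) * |u 0 - u' 0|)
    (fun t ht => (lipschitz_field (hL t (Ico_subset_Icc_self ht)) (k := fun z => z)
      (fun _ _ => le_rfl)).lipschitzOnWith)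
    (fun t ht => (h.hasDerivWithinAt_prodMk ht).continuousWithinAt)
    (fun t ht => hasDerivWithinAt_Ici_of_Icc
      (h.hasDerivWithinAt_prodMk (Ico_subset_Icc_self ht)) ht)
    (fun _ _ => trivial)
    (fun t ht => (h'.hasDerivWithinAt_prodMk ht).continuousWithinAt)
    (fun t ht => hasDerivWithinAt_Ici_of_Icc
      (h'.hasDerivWithinAt_prodMk (Ico_subset_Icc_self ht)) ht)
    (fun _ _ => trivial)
    (by
      rw [Prod.dist_eq]
      simp only [Real.dist_eq]
      rw [h.bc, h'.bc, ← mul_sub, abs_mul]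
      refine max_le ?_ ?_ <;> nlinarith [abs_nonneg a₀, abs_nonneg (u 0 - u' 0)]) x hx
  have hb : (1 + |a₀|) * |u 0 - u' 0| * Real.exp ((1 + L : NNReal) * (x - 0))
      ≤ (1 + |a₀|) * Real.exp ((1 + L : NNReal) * 1) * |u 0 - u' 0| := by
    rw [mul_right_comm]
    gcongr
    linarith [hx.2]
  have := key.trans hb
  rw [Prod.dist_eq] at this
  simp only [Real.dist_eq] at this
  exact ⟨(le_max_left _ _).trans this, (le_max_right _ _).trans this⟩

/-- Global existence of shots for Lipschitz nonlinearities. -/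
theorem exists_isShot {H : ℝ → ℝ → ℝ} {L : NNReal}
    (hL : ∀ x ∈ Icc (0 : ℝ) 1, ∀ u w, |H x u - H x w| ≤ L * |u - w|)
    (hH : ∀ u, ContinuousOn (fun x => H x u) (Icc 0 1)) (a₀ s : ℝ) :
    ∃ u v : ℝ → ℝ, IsShot H a₀ u v ∧ u 0 = s := by
  obtain ⟨P, hP⟩ := isCompact_Icc.exists_bound_of_continuousOn (hH 0)
  have hP0 : 0 ≤ P := (norm_nonneg _).trans (hP 0 ⟨le_rfl, zero_le_one⟩)
  set y₀ : ℝ × ℝ := (s, a₀ * s) with hy₀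
  -- `B` is the Gronwall bound for the unclamped system. Clamping the state at `B` makes the field
  -- bounded, so Picard–Lindelöf covers all of `[0,1]` at once; the solution obeys the same bound,
  -- so the clamp never acts.
  set B := gronwallBound ‖y₀‖ (1 + L) P 1 with hB
  have hmono := gronwallBound_mono (norm_nonneg y₀) hP0 (by positivity : (0 : ℝ) ≤ 1 + L)
  have hB0 : 0 ≤ B := by
    have := hmono zero_le_one
    rw [gronwallBound_x0] at this
    exact (norm_nonneg _).trans this
  set f : ℝ → ℝ × ℝ → ℝ × ℝ := fun t y => (clamp B y.2, H t (clamp B y.1)) with hf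
  have hHle : ∀ t ∈ Icc (0 : ℝ) 1, ∀ u, |H t u| ≤ L * |u| + P := by
    intro t ht u
    have h1 := hL t ht u 0
    have h2 := hP t ht
    rw [Real.norm_eq_abs] at h2
    rw [sub_zero] at h1
    have h3 := abs_sub_abs_le_abs_sub (H t u) (H t 0)
    linarith
  have hgrow : ∀ t ∈ Icc (0 : ℝ) 1, ∀ y, ‖f t y‖ ≤ (1 + L) * ‖y‖ + P := by
    intro t ht y
    have h1 : |y.1| ≤ ‖y‖ := norm_fst_le y
    have h2 : |y.2| ≤ ‖y‖ := norm_snd_le y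
    have h3 := abs_clamp_le_abs hB0 y.1
    have h4 := abs_clamp_le_abs hB0 y.2
    have h5 := hHle t ht (clamp B y.1)
    have hn := norm_nonneg y
    have hL0 : (0 : ℝ) ≤ L := L.2
    have h6 : (L : ℝ) * |clamp B y.1| ≤ L * ‖y‖ := by gcongr; exact h3.trans h1
    refine norm_prod_le_iff.2 ⟨?_, ?_⟩ <;> simp only [hf, Real.norm_eq_abs] <;> nlinarith
  have hbound : ∀ t ∈ Icc (0 : ℝ) 1, ∀ y, ‖f t y‖ ≤ B + (L * B + P) := by
    intro t ht y
    have h3 := abs_clamp_le hB0 y.1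
    have h4 := abs_clamp_le hB0 y.2
    have h5 := hHle t ht (clamp B y.1)
    have hL0 : (0 : ℝ) ≤ L := L.2
    have h6 : (L : ℝ) * |clamp B y.1| ≤ L * B := by gcongr
    have h7 : 0 ≤ (L : ℝ) * B := by positivity
    refine norm_prod_le_iff.2 ⟨?_, ?_⟩ <;> simp only [hf, Real.norm_eq_abs] <;> linarith
  have hC0 : 0 ≤ B + (L * B + P) := by positivity
  have hPL : IsPicardLindelof f (tmin := 0) (tmax := 1) ⟨0, le_rfl, zero_le_one⟩ y₀
      ⟨B + (L * B + P), hC0⟩ 0 ⟨B + (L * B + P), hC0⟩ (1 + L) :=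
    { lipschitzOnWith := fun t ht =>
        (lipschitz_field (hL t ht) (abs_clamp_sub_le B)).lipschitzOnWith
      continuousOn := fun y _ => continuousOn_const.prodMk (hH _)
      norm_le := fun t ht y _ => hbound t ht y
      mul_max_le := by simp }
  obtain ⟨α, hα0, hα⟩ := hPL.exists_eq_forall_mem_Icc_hasDerivWithinAt₀
  simp only at hα0
  have hle : ∀ t ∈ Icc (0 : ℝ) 1, ‖α t‖ ≤ B := by
    intro t ht
    have := norm_le_gronwallBound_of_norm_deriv_right_le (f := α) (f' := fun t => f t (α t))
      (δ := ‖y₀‖) (K := 1 + L) (ε := P) (a := 0) (b := 1)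
      (fun t ht => (hα t ht).continuousWithinAt)
      (fun t ht => hasDerivWithinAt_Ici_of_Icc (hα t (Ico_subset_Icc_self ht)) ht)
      (by rw [hα0]) (fun t ht => hgrow t (Ico_subset_Icc_self ht) _) t ht
    exact this.trans (hmono (by linarith [ht.2]))
  refine ⟨fun t => (α t).1, fun t => (α t).2, ⟨fun x hx => ?_, fun x hx => ?_, ?_⟩, ?_⟩
  · have := (ContinuousLinearMap.fst ℝ ℝ ℝ).hasFDerivAt.comp_hasDerivWithinAt x (hα x hx)
    rwa [← clamp_eq_self ((norm_snd_le (α x)).trans (hle x hx))]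
  · have := (ContinuousLinearMap.snd ℝ ℝ ℝ).hasFDerivAt.comp_hasDerivWithinAt x (hα x hx)
    rwa [← clamp_eq_self ((norm_fst_le (α x)).trans (hle x hx))]
  · simp [hα0, hy₀]
  · simp [hα0, hy₀]

theorem IsShot.isRadiationSolution {g : ℝ → ℝ → ℝ} {p u v : ℝ → ℝ} {a₀ a₁ : ℝ}
    (h : IsShot (fun x u => g x u + p x) a₀ u v) (h1 : v 1 = a₁ * u 1) :
    IsRadiationSolution g p a₀ a₁ u := by
  have hd : ∀ x ∈ Icc (0 : ℝ) 1, derivWithin u (Icc 0 1) x = v x := fun x hx =>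
    (h.hu x hx).derivWithin (uniqueDiffOn_Icc_zero_one x hx)
  refine ⟨fun x hx => (h.hu x hx).differentiableWithinAt,
    fun x hx => (h.hv x hx).congr hd (hd x hx), ?_, ?_⟩
  · rw [hd 0 ⟨le_rfl, zero_le_one⟩, h.bc]
  · rw [hd 1 ⟨zero_le_one, le_rfl⟩, h1]

theorem IsRadiationSolution.isShot {g : ℝ → ℝ → ℝ} {p u : ℝ → ℝ} {a₀ a₁ : ℝ}
    (h : IsRadiationSolution g p a₀ a₁ u) :
    IsShot (fun x u => g x u + p x) a₀ u (derivWithin u (Icc 0 1)) :=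
  ⟨fun x hx => (h.differentiableOn x hx).hasDerivWithinAt, h.equation, h.left_bc⟩

theorem IsShot.congr {H H' : ℝ → ℝ → ℝ} {a₀ : ℝ} {u v : ℝ → ℝ} (h : IsShot H a₀ u v)
    (hH : ∀ x ∈ Icc (0 : ℝ) 1, H x (u x) = H' x (u x)) : IsShot H' a₀ u v :=
  ⟨h.hu, fun x hx => hH x hx ▸ h.hv x hx, h.bc⟩

/-- Two shots of a nonlinearity increasing in `u` move apart. -/
theorem IsShot.sub_le_sub {H : ℝ → ℝ → ℝ} {a₀ : ℝ} (ha₀ : 0 < a₀)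
    (hmono : ∀ x ∈ Icc (0 : ℝ) 1, StrictMono (H x)) {u v u' v' : ℝ → ℝ}
    (h : IsShot H a₀ u v) (h' : IsShot H a₀ u' v') (hlt : u 0 < u' 0) :
    ∀ x ∈ Icc (0 : ℝ) 1, u' 0 - u 0 ≤ u' x - u x :=
  le_of_convex_where_pos (u := fun x => u' x - u x) (v := fun x => v' x - v x)
    (q := fun x => H x (u' x) - H x (u x)) ha₀
    (fun x hx => (h'.hu x hx).sub (h.hu x hx)) (fun x hx => (h'.hv x hx).sub (h.hv x hx))
    (fun x hx hpos => sub_pos.2 (hmono x hx (sub_pos.1 hpos)))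
    (by simp only [h.bc, h'.bc]; ring) (sub_pos.2 hlt)

/-- The difference satisfies the same linear boundary conditions and is convex where positive. Used
in both directions, this gives uniqueness. -/
theorem radiation_le_of_small {g : ℝ → ℝ → ℝ} {p u w : ℝ → ℝ} {a₀ a₁ : ℝ} (ha₀ : 0 < a₀)
    (ha₁ : a₁ < a₀ / (1 + a₀)) (hmono : ∀ x ∈ Icc (0 : ℝ) 1, StrictMono (g x))
    (hu : IsRadiationSolution g p a₀ a₁ u) (hw : IsRadiationSolution g p a₀ a₁ w) :
    ∀ x ∈ Icc (0 : ℝ) 1, u x ≤ w x := by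
  intro x hx
  have := nonpos_of_convex_where_pos (u := fun x => u x - w x)
    (v := fun x => derivWithin u (Icc 0 1) x - derivWithin w (Icc 0 1) x)
    (q := fun x => (g x (u x) + p x) - (g x (w x) + p x)) ha₀ ha₁
    (fun x hx => (hu.isShot.hu x hx).sub (hw.isShot.hu x hx))
    (fun x hx => (hu.isShot.hv x hx).sub (hw.isShot.hv x hx))
    (fun x hx hpos => by have := hmono x hx (sub_pos.1 hpos); linarith)
    (by simp only [hu.left_bc, hw.left_bc]; ring)
    (by simp only [hu.right_bc, hw.right_bc]; ring) x hx
  linarith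

/-! ### Truncated nonlinearity and a priori bounds -/

/-- `H` is Lipschitz in `u`, increasing, agrees with `g + p` for `|u| ≤ N`, and grows at least
like `M u` for `|u| ≥ R`. -/
structure IsTruncation (g : ℝ → ℝ → ℝ) (p : ℝ → ℝ) (M R N : ℝ) (L : NNReal)
    (H : ℝ → ℝ → ℝ) : Prop where
  lipschitz : ∀ x ∈ Icc (0 : ℝ) 1, ∀ u w, |H x u - H x w| ≤ L * |u - w|
  continuousOn : ∀ u, ContinuousOn (fun x => H x u) (Icc 0 1)
  strictMono : ∀ x ∈ Icc (0 : ℝ) 1, StrictMono (H x)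
  eq : ∀ x ∈ Icc (0 : ℝ) 1, ∀ u, |u| ≤ N → H x u = g x u + p x
  le_right : ∀ x ∈ Icc (0 : ℝ) 1, ∀ u, R ≤ u → M * u ≤ H x u
  le_left : ∀ x ∈ Icc (0 : ℝ) 1, ∀ u, u ≤ -R → H x u ≤ M * u

theorem exists_lipschitz_of_isC1InSecond {g : ℝ → ℝ → ℝ} (hg : IsC1InSecond g) (N : ℝ) :
    ∃ D : ℝ, 0 ≤ D ∧ ∀ x ∈ Icc (0 : ℝ) 1, ∀ u ∈ Icc (-N) N, ∀ w ∈ Icc (-N) N,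
      |g x u - g x w| ≤ D * |u - w| := by
  obtain ⟨D, hD⟩ := (isCompact_Icc.prod isCompact_Icc).exists_bound_of_continuousOn
    (hg.continuousOn_deriv.mono (prod_mono le_rfl (subset_univ (Icc (-N) N))))
  refine ⟨max D 0, le_max_right _ _, fun x hx u hu w hw => ?_⟩
  exact (convex_Icc (-N) N).norm_image_sub_le_of_norm_deriv_le
    (fun y _ => hg.differentiable x hx y)
    (fun y hy => (hD (x, y) ⟨hx, hy⟩).trans (le_max_left _ _)) hw hu

theorem exists_isTruncation {g : ℝ → ℝ → ℝ} {p : ℝ → ℝ} (hg : IsC1InSecond g)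
    (hsuper : IsSuperlinear g) (hmono : ∀ x ∈ Icc (0 : ℝ) 1, StrictMono (g x))
    (hp : ContinuousOn p (Icc (0 : ℝ) 1)) (hpos : ∀ x ∈ Icc (0 : ℝ) 1, 0 < p x)
    {M : ℝ} (hM : 0 ≤ M) :
    ∃ R : ℝ, 0 < R ∧ ∀ N, R ≤ N → ∃ L H, IsTruncation g p M R N L H := by
  obtain ⟨P, hP⟩ := isCompact_Icc.exists_bound_of_continuousOn hp
  have hpP : ∀ x ∈ Icc (0 : ℝ) 1, p x ≤ P := fun x hx => (le_abs_self _).trans (hP x hx)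
  have hP0 : 0 < P :=
    (hpos 0 ⟨le_rfl, zero_le_one⟩).trans_le (hpP 0 ⟨le_rfl, zero_le_one⟩)
  -- The extra slope `P` absorbs `p` on the negative side: `P u + p ≤ 0` for `u ≤ -1`, which is why
  -- `R` is taken at least `1`.
  obtain ⟨R₀, hR₀, hR⟩ := hsuper (M + P)
  refine ⟨max R₀ 1, by positivity, fun N hN => ?_⟩
  have hR1 : 1 ≤ max R₀ 1 := le_max_right _ _
  have hRR : R₀ ≤ max R₀ 1 := le_max_left _ _
  have hN0 : 0 ≤ N := by linarith
  have hgr : ∀ x ∈ Icc (0 : ℝ) 1, ∀ u, max R₀ 1 ≤ u → (M + P) * u ≤ g x u := by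
    intro x hx u hu
    have hu0 : 0 < u := by linarith
    exact (le_div_iff₀ hu0).1 (hR x hx u (by rw [abs_of_pos hu0]; linarith))
  have hgl : ∀ x ∈ Icc (0 : ℝ) 1, ∀ u, u ≤ -max R₀ 1 → g x u ≤ (M + P) * u := by
    intro x hx u hu
    have hu0 : u < 0 := by linarith
    exact (le_div_iff_of_neg hu0).1 (hR x hx u (by rw [abs_of_neg hu0]; linarith))
  obtain ⟨D, hD0, hD⟩ := exists_lipschitz_of_isC1InSecond hg N
  set K := M + P with hK
  have hK0 : 0 < K := by linarith
  -- Beyond `±N` the function is continued linearly with slope `K`, which preserves monotonicity and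
  -- growth. The `2 * K` comes from the crude Lipschitz constant `2` of `u - clamp N u`.
  refine ⟨⟨D + 2 * K, by positivity⟩,
    fun x u => g x (clamp N u) + K * (u - clamp N u) + p x, ?_, ?_, ?_, ?_, ?_, ?_⟩
  · intro x hx u w
    have h1 := hD x hx (clamp N u) (abs_le.1 (abs_clamp_le hN0 u)) (clamp N w)
      (abs_le.1 (abs_clamp_le hN0 w))
    have h2 := abs_clamp_sub_le N u w
    have h3 : D * |clamp N u - clamp N w| ≤ D * |u - w| := by gcongr
    have h4 : |(u - w) - (clamp N u - clamp N w)| ≤ 2 * |u - w| :=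
      (abs_sub _ _).trans (by linarith)
    have h5 : K * |(u - w) - (clamp N u - clamp N w)| ≤ K * (2 * |u - w|) := by gcongr
    calc _ = |(g x (clamp N u) - g x (clamp N w))
            + K * ((u - w) - (clamp N u - clamp N w))| := by congr 1; ring
      _ ≤ |g x (clamp N u) - g x (clamp N w)|
            + K * |(u - w) - (clamp N u - clamp N w)| := by
          refine (abs_add_le _ _).trans_eq ?_
          rw [abs_mul, abs_of_pos hK0]
      _ ≤ (D + 2 * K) * |u - w| := by linarith
  · intro u
    refine ((hg.continuousOn.comp (f := fun x => (x, clamp N u)) (by fun_prop)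
      (fun x hx => ⟨hx, mem_univ _⟩)).add continuousOn_const).add hp
  · intro x hx u w huw
    have h1 := (clamp_mono N) huw.le
    have h2 := abs_clamp_sub_le N w u
    rw [abs_of_nonneg (sub_nonneg.2 h1), abs_of_pos (sub_pos.2 huw)] at h2
    simp only
    rcases h1.eq_or_lt with h | h
    · rw [h]; nlinarith
    · have := hmono x hx h
      nlinarith
  · intro x hx u hu
    simp only [clamp_eq_self hu]
    ring
  · intro x hx u hu
    have hp0 := hpos x hx
    have hPu : 0 ≤ P * u := by have : 0 ≤ u := by linarith
                               positivity
    rcases le_total u N with h | h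
    · rw [clamp_eq_self (abs_le.2 ⟨by linarith, h⟩)]
      have := hgr x hx u hu
      nlinarith
    · rw [clamp_eq_right hN0 h]
      have := hgr x hx N hN
      nlinarith
  · intro x hx u hu
    have hp0 := hpP x hx
    have hPu : P * u ≤ -P := by nlinarith
    rcases le_total (-N) u with h | h
    · rw [clamp_eq_self (abs_le.2 ⟨h, by linarith⟩)]
      have := hgl x hx u hu
      nlinarith
    · rw [clamp_eq_left hN0 h]
      have := hgl x hx (-N) (by linarith)
      nlinarith

section Truncation

variable {g : ℝ → ℝ → ℝ} {p : ℝ → ℝ} {M R N a₀ a₁ : ℝ} {L : NNReal} {H : ℝ → ℝ → ℝ}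

/-- Intermediate value theorem in the initial value: the end data of a shot are Lipschitz functions
of it. The weights `α, β` cover both the condition `u(1) = 0` and `±(u'(1) - a₁ u(1)) = 0`. -/
theorem IsTruncation.exists_between (T : IsTruncation g p M R N L H) (α β : ℝ)
    {u v u' v' : ℝ → ℝ} (h : IsShot H a₀ u v) (h' : IsShot H a₀ u' v') (hlt : u 0 < u' 0)
    (hneg : α * v 1 + β * u 1 < 0) (hpos : 0 < α * v' 1 + β * u' 1) :
    ∃ w y : ℝ → ℝ, IsShot H a₀ w y ∧ u 0 < w 0 ∧ w 0 < u' 0 ∧ α * y 1 + β * w 1 = 0 := by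
  choose U V hUV hU0 using exists_isShot T.lipschitz T.continuousOn a₀
  obtain ⟨C, hC, hdist⟩ := IsShot.dist_le (a₀ := a₀) T.lipschitz
  have h11 : (1 : ℝ) ∈ Icc (0 : ℝ) 1 := ⟨zero_le_one, le_rfl⟩
  have huniq : ∀ u v, IsShot H a₀ u v → U (u 0) 1 = u 1 ∧ V (u 0) 1 = v 1 := by
    intro u v h
    have := hdist _ _ _ _ (hUV (u 0)) h 1 h11
    rw [hU0, sub_self, abs_zero, mul_zero] at this
    exact ⟨sub_eq_zero.1 (abs_nonpos_iff.1 this.1), sub_eq_zero.1 (abs_nonpos_iff.1 this.2)⟩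
  have hcU : Continuous fun s => U s 1 :=
    (LipschitzWith.of_dist_le_mul (K := ⟨C, hC.le⟩) fun s t => by
      have := (hdist _ _ _ _ (hUV s) (hUV t) 1 h11).1
      rwa [hU0, hU0] at this).continuous
  have hcV : Continuous fun s => V s 1 :=
    (LipschitzWith.of_dist_le_mul (K := ⟨C, hC.le⟩) fun s t => by
      have := (hdist _ _ _ _ (hUV s) (hUV t) 1 h11).2
      rwa [hU0, hU0] at this).continuous
  have hc : Continuous fun s => α * V s 1 + β * U s 1 :=
    (hcV.const_mul α).add (hcU.const_mul β)
  obtain ⟨s, hs, hs0⟩ := intermediate_value_Ioo hlt.le hc.continuousOn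
    (show (0 : ℝ) ∈ Ioo _ _ by
      rw [(huniq u v h).1, (huniq u v h).2, (huniq u' v' h').1, (huniq u' v' h').2]
      exact ⟨hneg, hpos⟩)
  exact ⟨U s, V s, hUV s, by rw [hU0]; exact hs.1, by rw [hU0]; exact hs.2, hs0⟩

/-- Assuming only an inequality at `1` lets the bound also fix, by contradiction, the sign of `F` at
extreme shots. -/
theorem IsTruncation.lt_of_le {n : ℕ} (T : IsTruncation g p ((n : ℝ) ^ 2 + 1) R N L H)
    (ha₀ : 0 < a₀) (hR : 0 < R) (hn : 2 ≤ n) (hna : 2 * a₁ ≤ n) {u v : ℝ → ℝ}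
    (h : IsShot H a₀ u v) (h1 : v 1 ≤ a₁ * u 1) :
    ∀ x ∈ Icc (0 : ℝ) 1, u x < 2 * R :=
  lt_of_superlinear ha₀ hR hn hna h.hu h.hv (fun x hx hRu => T.le_right x hx _ hRu) h.bc h1

theorem IsTruncation.neg_lt_of_le {n : ℕ} (T : IsTruncation g p ((n : ℝ) ^ 2 + 1) R N L H)
    (ha₀ : 0 < a₀) (hR : 0 < R) (hn : 2 ≤ n) (hna : 2 * a₁ ≤ n) {u v : ℝ → ℝ}
    (h : IsShot H a₀ u v) (h1 : a₁ * u 1 ≤ v 1) :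
    ∀ x ∈ Icc (0 : ℝ) 1, -u x < 2 * R :=
  lt_of_superlinear (u := fun x => -u x) (v := fun x => -v x) (q := fun x => -H x (u x))
    ha₀ hR hn hna (fun x hx => (h.hu x hx).neg) (fun x hx => (h.hv x hx).neg)
    (fun x hx hRu => by have := T.le_left x hx (u x) (by linarith); linarith)
    (by simp only [h.bc]; ring) (by linarith)

theorem IsTruncation.isRadiationSolution {n : ℕ}
    (T : IsTruncation g p ((n : ℝ) ^ 2 + 1) R N L H)
    (ha₀ : 0 < a₀) (hR : 0 < R) (hn : 2 ≤ n) (hna : 2 * a₁ ≤ n) (hN : 2 * R ≤ N) {u v : ℝ → ℝ}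
    (h : IsShot H a₀ u v) (h1 : v 1 = a₁ * u 1) : IsRadiationSolution g p a₀ a₁ u := by
  refine IsShot.isRadiationSolution (h.congr fun x hx => T.eq x hx _ (abs_le.2 ⟨?_, ?_⟩)) h1
  · have := T.neg_lt_of_le ha₀ hR hn hna h h1.ge x hx
    linarith
  · have := T.lt_of_le ha₀ hR hn hna h h1.le x hx
    linarith

theorem IsTruncation.pos (T : IsTruncation g p M R N L H) (hN : 0 ≤ N)
    (hg0 : ∀ x ∈ Icc (0 : ℝ) 1, g x 0 = 0) (hpos : ∀ x ∈ Icc (0 : ℝ) 1, 0 < p x) {x u : ℝ}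
    (hx : x ∈ Icc (0 : ℝ) 1) (hu : 0 ≤ u) : 0 < H x u := by
  have h0 : H x 0 = p x := by rw [T.eq x hx 0 (by simpa using hN), hg0 x hx, zero_add]
  have := (T.strictMono x hx).monotone hu
  have := hpos x hx
  linarith

end Truncation

/-! ### Signs of shots and the base shots -/

/-- At a nonnegative maximum `u'' > 0`, so it is an end point with outward slope; at `0` this would
need `a₀ u(0) < 0`. -/
theorem IsShot.eq_one_of_isMax {H : ℝ → ℝ → ℝ} {a₀ : ℝ} {u v : ℝ → ℝ} (ha₀ : 0 < a₀)
    (h : IsShot H a₀ u v) (hH : ∀ x ∈ Icc (0 : ℝ) 1, ∀ u, 0 ≤ u → 0 < H x u) {x : ℝ}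
    (hx : x ∈ Icc (0 : ℝ) 1) (hmax : ∀ y ∈ Icc (0 : ℝ) 1, u y ≤ u x) (hux : 0 ≤ u x) :
    x = 1 ∧ 0 < v 1 := by
  rcases isMaxOn_deriv_pos_endpoint zero_lt_one h.hu h.hv hx hmax (hH x hx _ hux) with
    ⟨rfl, h0⟩ | h1
  · have : 0 ≤ a₀ * u 0 := by positivity
    linarith [h.bc]
  · exact h1

theorem IsShot.exists_max {H : ℝ → ℝ → ℝ} {a₀ : ℝ} {u v : ℝ → ℝ} (h : IsShot H a₀ u v) :
    ∃ x ∈ Icc (0 : ℝ) 1, ∀ y ∈ Icc (0 : ℝ) 1, u y ≤ u x :=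
  isCompact_Icc.exists_isMaxOn (nonempty_Icc.2 zero_le_one)
    (fun x hx => (h.hu x hx).continuousWithinAt)

theorem IsShot.isNegativeOnUnit {H : ℝ → ℝ → ℝ} {a₀ : ℝ} {u v : ℝ → ℝ} (ha₀ : 0 < a₀)
    (h : IsShot H a₀ u v) (hH : ∀ x ∈ Icc (0 : ℝ) 1, ∀ u, 0 ≤ u → 0 < H x u)
    (h1 : u 1 < 0) : IsNegativeOnUnit u := by
  obtain ⟨x, hx, hmax⟩ := h.exists_max
  intro y hy
  by_contra! hy0
  have := (h.eq_one_of_isMax ha₀ hH hx hmax (hy0.trans (hmax y hy))).1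
  subst this
  linarith [hmax y hy]

theorem IsShot.of_apply_one_eq_zero {H : ℝ → ℝ → ℝ} {a₀ : ℝ} {u v : ℝ → ℝ} (ha₀ : 0 < a₀)
    (h : IsShot H a₀ u v) (hH : ∀ x ∈ Icc (0 : ℝ) 1, ∀ u, 0 ≤ u → 0 < H x u)
    (h1 : u 1 = 0) : 0 < v 1 ∧ u 0 < 0 ∧ ∀ x ∈ Icc (0 : ℝ) 1, u x ≤ 0 := by
  obtain ⟨x, hx, hmax⟩ := h.exists_max
  obtain ⟨rfl, hv⟩ := h.eq_one_of_isMax ha₀ hH hx hmax (h1 ▸ hmax 1 ⟨zero_le_one, le_rfl⟩)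
  rw [h1] at hmax
  refine ⟨hv, ?_, hmax⟩
  by_contra! h0
  exact zero_ne_one (h.eq_one_of_isMax ha₀ hH ⟨le_rfl, zero_le_one⟩
    (fun y hy => (hmax y hy).trans h0) h0).1

/-- A negative shot vanishing at `1`, together with a sign-changing shot starting slightly above
it. -/
theorem exists_base_shots {g : ℝ → ℝ → ℝ} {p : ℝ → ℝ} {a₀ : ℝ} (hg : IsC1InSecond g)
    (hg0 : ∀ x ∈ Icc (0 : ℝ) 1, g x 0 = 0)
    (hsuper : IsSuperlinear g) (hmono : ∀ x ∈ Icc (0 : ℝ) 1, StrictMono (g x))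
    (hp : ContinuousOn p (Icc (0 : ℝ) 1)) (hpos : ∀ x ∈ Icc (0 : ℝ) 1, 0 < p x)
    (ha₀ : 0 < a₀) :
    ∃ (u v u' v' : ℝ → ℝ) (r : ℝ), IsShot (fun x u => g x u + p x) a₀ u v ∧
      IsShot (fun x u => g x u + p x) a₀ u' v' ∧
      (∀ x ∈ Icc (0 : ℝ) 1, |u x| ≤ r ∧ |u' x| ≤ r) ∧
      u 0 < u' 0 ∧ u' 0 < 0 ∧ u 1 = 0 ∧ 0 < v 1 ∧ 0 < u' 1 := by
  have h01 : (1 : ℝ) ∈ Icc (0 : ℝ) 1 := ⟨zero_le_one, le_rfl⟩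
  obtain ⟨R, hR, hT⟩ := exists_isTruncation hg hsuper hmono hp hpos (zero_le_one (α := ℝ))
  obtain ⟨L, H, T⟩ := hT (2 * R) (by linarith)
  have hH : ∀ x ∈ Icc (0 : ℝ) 1, ∀ u, 0 ≤ u → 0 < H x u := fun x hx u hu =>
    T.pos (by linarith) hg0 hpos hx hu
  choose U V hUV hU0 using exists_isShot T.lipschitz T.continuousOn a₀
  -- Moving the initial value from `0` by `|U 0 1| + 1` moves the end value at least as far, hence
  -- past zero.
  obtain ⟨u, v, h, -, -, h1⟩ : ∃ u v : ℝ → ℝ, IsShot H a₀ u v ∧ U (-|U 0 1| - 1) 0 < u 0 ∧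
      u 0 < U (|U 0 1| + 1) 0 ∧ 0 * v 1 + 1 * u 1 = 0 := by
    have ha := abs_nonneg (U 0 1)
    refine T.exists_between 0 1 (hUV (-|U 0 1| - 1)) (hUV (|U 0 1| + 1)) ?_ ?_ ?_
    · rw [hU0, hU0]; linarith
    · have := (hUV (-|U 0 1| - 1)).sub_le_sub ha₀ T.strictMono (hUV 0)
        (by rw [hU0, hU0]; linarith) 1 h01
      rw [hU0, hU0] at this
      linarith [le_abs_self (U 0 1)]
    · have := (hUV 0).sub_le_sub ha₀ T.strictMono (hUV (|U 0 1| + 1))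
        (by rw [hU0, hU0]; linarith) 1 h01
      rw [hU0, hU0] at this
      linarith [neg_abs_le (U 0 1)]
  have h1' : u 1 = 0 := by linarith
  obtain ⟨hv1, hu0, hule⟩ := h.of_apply_one_eq_zero ha₀ hH h1'
  -- A minimum below `-R` has `u'' < 0`, so it is an end point; at `0` the slope `a₀ u(0) < 0` has
  -- the wrong sign, and `u(1) = 0`.
  have hlow : ∀ x ∈ Icc (0 : ℝ) 1, -u x ≤ R := by
    obtain ⟨x, hx, hmin⟩ := isCompact_Icc.exists_isMinOn (nonempty_Icc.2 zero_le_one)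
      (fun x hx => (h.hu x hx).continuousWithinAt : ContinuousOn u (Icc 0 1))
    intro y hy
    by_contra! hyR
    have hyx : u x ≤ u y := hmin hy
    rcases isMaxOn_deriv_pos_endpoint zero_lt_one (u := fun x => -u x) (v := fun x => -v x)
      (q := fun x => -H x (u x)) (fun x hx => (h.hu x hx).neg) (fun x hx => (h.hv x hx).neg) hx
      (fun z hz => neg_le_neg (hmin hz))
      (by have := T.le_left x hx (u x) (by linarith); linarith) with ⟨rfl, h0⟩ | ⟨rfl, -⟩
    · rw [h.bc] at h0
      nlinarith
    · linarith
  have habs : ∀ x ∈ Icc (0 : ℝ) 1, |u x| ≤ R := fun x hx =>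
    abs_le.2 ⟨by linarith [hlow x hx], by linarith [hule x hx]⟩
  obtain ⟨C, hC, hdist⟩ := IsShot.dist_le (a₀ := a₀) T.lipschitz
  -- The first bound keeps the new initial value negative; the second keeps the new shot within `2 *
  -- R`, where the truncation is inactive.
  set δ := min (-u 0 / 2) (R / C) with hδ
  have hδ0 : 0 < δ := lt_min (by linarith) (by positivity)
  have hδ1 : δ ≤ -u 0 / 2 := min_le_left _ _
  have hδ2 : C * δ ≤ R := by
    have : δ ≤ R / C := min_le_right _ _
    rw [le_div_iff₀ hC] at this
    linarith
  have h' := hUV (u 0 + δ)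
  have h'0 := hU0 (u 0 + δ)
  have habs' : ∀ x ∈ Icc (0 : ℝ) 1, |U (u 0 + δ) x| ≤ 2 * R := by
    intro x hx
    have h2 := (hdist _ _ _ _ h' h x hx).1
    rw [h'0, add_sub_cancel_left, abs_of_pos hδ0] at h2
    have h3 := abs_sub_abs_le_abs_sub (U (u 0 + δ) x) (u x)
    linarith [habs x hx]
  refine ⟨u, v, U (u 0 + δ), V (u 0 + δ), 2 * R,
    h.congr fun x hx => T.eq x hx _ (by linarith [habs x hx]),
    h'.congr fun x hx => T.eq x hx _ (habs' x hx),
    fun x hx => ⟨by linarith [habs x hx], habs' x hx⟩, by linarith, by linarith, h1', hv1, ?_⟩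
  have := h.sub_le_sub ha₀ T.strictMono h' (by linarith) 1 h01
  linarith

/-! ### Counting zeros of the shooting function -/

theorem mainTheorem2 (g : ℝ → ℝ → ℝ) (p : ℝ → ℝ) (a₀ : ℝ)
    (hg : IsC1InSecond g)
    (hg0 : ∀ x ∈ Icc (0 : ℝ) 1, g x 0 = 0)
    (hsuper : IsSuperlinear g)
    (hmono : ∀ x ∈ Icc (0 : ℝ) 1, StrictMono (g x))
    (hp : ContinuousOn p (Icc (0 : ℝ) 1))
    (hpos : ∀ x ∈ Icc (0 : ℝ) 1, 0 < p x)
    (ha₀ : 0 < a₀) :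
    ∃ aLow aHigh : ℝ, 0 < aLow ∧ aLow < aHigh ∧
      (∀ a₁ : ℝ, aHigh < a₁ →
        ∃ u v w : ℝ → ℝ,
          IsRadiationSolution g p a₀ a₁ u ∧ IsRadiationSolution g p a₀ a₁ v ∧
          IsRadiationSolution g p a₀ a₁ w ∧
          ¬ EqOn u v (Icc (0 : ℝ) 1) ∧ ¬ EqOn u w (Icc (0 : ℝ) 1) ∧
          ¬ EqOn v w (Icc (0 : ℝ) 1) ∧
          IsNegativeOnUnit u ∧ IsSignChangingOnUnit v) ∧
      (∀ a₁ : ℝ, 0 < a₁ → a₁ < aLow →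
        ∃ u : ℝ → ℝ,
          IsRadiationSolution g p a₀ a₁ u ∧ IsNegativeOnUnit u ∧
          ∀ v : ℝ → ℝ, IsRadiationSolution g p a₀ a₁ v → EqOn v u (Icc (0 : ℝ) 1)) := by
  have h00 : (0 : ℝ) ∈ Icc (0 : ℝ) 1 := ⟨le_rfl, zero_le_one⟩
  have h01 : (1 : ℝ) ∈ Icc (0 : ℝ) 1 := ⟨zero_le_one, le_rfl⟩
  obtain ⟨u, v, u', v', r, hu, hu', hr, hlt, hneg, hu1, hv1, hu1'⟩ :=
    exists_base_shots hg hg0 hsuper hmono hp hpos ha₀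
  have setup : ∀ a₁ : ℝ, ∃ (n : ℕ) (R N : ℝ) (L : NNReal) (H : ℝ → ℝ → ℝ), 2 ≤ n ∧ 2 * a₁ ≤ n ∧
      0 < R ∧ 2 * R ≤ N ∧ IsTruncation g p ((n : ℝ) ^ 2 + 1) R N L H ∧ IsShot H a₀ u v ∧
      IsShot H a₀ u' v' := by
    intro a₁
    obtain ⟨k, hk⟩ := exists_nat_ge (2 * a₁)
    obtain ⟨R, hR, hT⟩ := exists_isTruncation hg hsuper hmono hp hpos
      (by positivity : (0 : ℝ) ≤ ((k + 2 : ℕ) : ℝ) ^ 2 + 1)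
    -- The level `2 * R` makes truncated solutions genuine; `r` makes the base shots, fixed before
    -- `a₁`, shots of every truncation.
    obtain ⟨L, H, T⟩ := hT (max (2 * R) r) ((by linarith : R ≤ 2 * R).trans (le_max_left _ _))
    refine ⟨k + 2, R, _, L, H, by omega, by push_cast; linarith, hR, le_max_left _ _, T,
      hu.congr fun x hx => ?_, hu'.congr fun x hx => ?_⟩
    · exact (T.eq x hx _ ((hr x hx).1.trans (le_max_right _ _))).symm
    · exact (T.eq x hx _ ((hr x hx).2.trans (le_max_right _ _))).symm
  have exists_neg : ∀ a₁ : ℝ, ∃ w : ℝ → ℝ, IsRadiationSolution g p a₀ a₁ w ∧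
      IsNegativeOnUnit w ∧ w 0 < u 0 := by
    intro a₁
    obtain ⟨n, R, N, L, H, hn, hna, hR, hN, T, h, -⟩ := setup a₁
    -- By separation `w(1) ≤ -2R`, so the a priori bound forces `F < 0` at this shot.
    obtain ⟨w, y, hw, hw0⟩ := exists_isShot T.lipschitz T.continuousOn a₀ (u 0 - 2 * R)
    have hw1 := hw.sub_le_sub ha₀ T.strictMono h (by linarith) 1 h01
    obtain ⟨z, z', hz, -, hz0, hz1⟩ := T.exists_between 1 (-a₁) hw h (by linarith)
      (by
        by_contra! hc
        linarith [T.neg_lt_of_le ha₀ hR hn hna hw (by linarith) 1 h01])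
      (by rw [hu1]; linarith)
    refine ⟨z, T.isRadiationSolution ha₀ hR hn hna hN hz (by linarith),
      hz.isNegativeOnUnit ha₀ (fun x hx u hu => T.pos (by linarith) hg0 hpos hx hu) ?_, hz0⟩
    linarith [hz.sub_le_sub ha₀ T.strictMono h hz0 1 h01]
  have hlow : 0 < a₀ / (1 + a₀) := by positivity
  -- Above `v' 1 / u' 1` the second base shot has `F < 0`; the maximum and the `+ 1` serve to order
  -- the two constants strictly.
  refine ⟨a₀ / (1 + a₀), max (v' 1 / u' 1) (a₀ / (1 + a₀)) + 1, hlow, ?_, ?_, ?_⟩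
  · linarith [le_max_right (v' 1 / u' 1) (a₀ / (1 + a₀))]
  · intro a₁ ha₁
    have hva : v' 1 < a₁ * u' 1 :=
      (div_lt_iff₀ hu1').1 (by linarith [le_max_left (v' 1 / u' 1) (a₀ / (1 + a₀))])
    obtain ⟨u₁, hs₁, hn₁, hl₁⟩ := exists_neg a₁
    obtain ⟨n, R, N, L, H, hn, hna, hR, hN, T, h, h'⟩ := setup a₁
    obtain ⟨u₂, v₂, h₂, hl₂, hl₂', he₂⟩ := T.exists_between (-1) a₁ h h' hlt
      (by rw [hu1]; linarith) (by linarith)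
    obtain ⟨w, y, hw, hw0⟩ := exists_isShot T.lipschitz T.continuousOn a₀ (u' 0 + 2 * R)
    have hw1 := h'.sub_le_sub ha₀ T.strictMono hw (by linarith) 1 h01
    obtain ⟨u₃, v₃, h₃, hl₃, -, he₃⟩ := T.exists_between 1 (-a₁) h' hw (by linarith)
      (by linarith)
      (by
        by_contra! hc
        linarith [T.lt_of_le ha₀ hR hn hna hw (by linarith) 1 h01])
    refine ⟨u₁, u₂, u₃, hs₁, T.isRadiationSolution ha₀ hR hn hna hN h₂ (by linarith),
      T.isRadiationSolution ha₀ hR hn hna hN h₃ (by linarith), fun he => ?_, fun he => ?_,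
      fun he => ?_, hn₁, ⟨0, h00, by linarith⟩, ⟨1, h01, ?_⟩⟩
    -- The three initial values are separated by `u 0` and `u' 0`.
    · linarith [he h00]
    · linarith [he h00]
    · linarith [he h00]
    · linarith [h.sub_le_sub ha₀ T.strictMono h₂ hl₂ 1 h01]
  · intro a₁ _ ha₁
    obtain ⟨w, hw, hwn, -⟩ := exists_neg a₁
    exact ⟨w, hw, hwn, fun z hz x hx => le_antisymm
      (radiation_le_of_small ha₀ ha₁ hmono hz hw x hx)
      (radiation_le_of_small ha₀ ha₁ hmono hw hz x hx)⟩
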